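/- Let $(N,h)$ be a smooth $n$-dimensional Riemannian manifold ($n\ge 1$) with Levi-Civita connection $\nabla$ and Riemann curvature tensor $R$, and let $\gamma:\mathbb R\to N$ be a geodesic parametrized by arc-length. Suppose that $N$ is locally symmetric along $\gamma$, i.e. $\nabla_{\dot\gamma}\nabla^jR|_\gamma=0$ for all $j\ge 0$. Let $e_1=\dot\gamma$, and let $e_2,\dots,e_n$ be parallel vector fields along $\gamma$ such that $(e_1,\dots,e_n)$ is orthonormal at $\gamma(0)$. The geodesic normal coordinates $(x^1,\dots,x^n)=(x^1,\hat x)$ around $\gamma$ are given by the smooth parametrization $$\sigma(x^1,\hat x)=\exp_{\gamma(x^1)}\Big(\sum_{j=2}^n x^je_j(x^1)\Big),$$ defined on a neighbourhood of the axis $\{\hat x=0\}$ in $\mathbb R^n$, the axis corresponding to $\gamma$. Let $\partial_i=\partial/\partial x^i$, and let $\Gamma^i_{jk}$ be the Christoffel symbols of $h$ in these coordinates, i.e. those of the metric components $h(\partial_i\sigma,\partial_j\sigma)$. Then the functions $\Gamma^i_{jk}$ are smooth near the axis, and for all $q\ge 0$ and all $i,j,k\in\{1,\dots,n\}$, $$\partial_1^q\partial_1\partial_j\Gamma^i_{1k}\big|_\gamma=\partial_1^q\partial_1\Gamma^i_{1k}\big|_\gamma=0,$$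 $$\partial_1^q\partial_j\partial_k\Gamma^1_{11}\big|_\gamma=\partial_1^q\partial_k\Gamma^1_{11}\big|_\gamma=\partial_1^q\Gamma^1_{11}\big|_\gamma=0 .$$ -/

import Mathlib

open scoped Manifold ContDiff Topology

noncomputable section

namespace GeodesicCoords

/-! The space of coordinates is `EuclideanSpace ℝ (Fin n)`. Indices run over `Fin n`; the index `0`
is the distinguished first coordinate `x¹`, the indices `≠ 0` are the transversal ones. -/

/-- The partial derivative `∂ᵢ f`. -/
def pd {n : ℕ} (i : Fin n) (f : EuclideanSpace ℝ (Fin n) → ℝ) (x : EuclideanSpace ℝ (Fin n)) : ℝ :=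
  fderiv ℝ f x (EuclideanSpace.single i 1)

/-! ### Local Riemannian geometry of a matrix-valued function of the coordinates -/

/-- The Christoffel symbol `Γⁱⱼₖ` of the metric with components `G`. -/
def christoffel {n : ℕ} (G : EuclideanSpace ℝ (Fin n) → Matrix (Fin n) (Fin n) ℝ) (i j k : Fin n)
    (x : EuclideanSpace ℝ (Fin n)) : ℝ :=
  (1 / 2 : ℝ) * ∑ l, (G x)⁻¹ i l *
    (pd j (fun y => G y k l) x + pd k (fun y => G y j l) x - pd l (fun y => G y j k) x)

/-- The components `Rⁱⱼₖₗ` of the Riemann curvature tensor, in the convention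
`(∇ⱼ∇ₖ - ∇ₖ∇ⱼ) ∂ₗ = Rⁱⱼₖₗ ∂ᵢ`; the lower indices `j, k, l` are `a 0, a 1, a 2`. -/
def riemann {n : ℕ} (G : EuclideanSpace ℝ (Fin n) → Matrix (Fin n) (Fin n) ℝ)
    (x : EuclideanSpace ℝ (Fin n)) (a : Fin 3 → Fin n) (i : Fin n) : ℝ :=
  pd (a 0) (christoffel G i (a 1) (a 2)) x - pd (a 1) (christoffel G i (a 0) (a 2)) x
    + ∑ m, (christoffel G i (a 0) m x * christoffel G m (a 1) (a 2) x
      - christoffel G i (a 1) m x * christoffel G m (a 0) (a 2) x)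

/-- The components of the covariant derivative of a tensor field `T` with `m` lower indices and one
upper index. The new lower index, the direction of differentiation, is put first:
`(∇T)ⁱ_{b a₀ … aₘ₋₁} = ∂_b Tⁱ_{a₀ …} + Γⁱ_{b p} Tᵖ_{a₀ …} - ∑ₛ Γᵖ_{b aₛ} Tⁱ_{a₀ … p … aₘ₋₁}`. -/
def covDeriv {n m : ℕ} (G : EuclideanSpace ℝ (Fin n) → Matrix (Fin n) (Fin n) ℝ)
    (T : EuclideanSpace ℝ (Fin n) → (Fin m → Fin n) → Fin n → ℝ)
    (x : EuclideanSpace ℝ (Fin n)) (a : Fin (m + 1) → Fin n) (i : Fin n) : ℝ :=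
  pd (a 0) (fun y => T y (Fin.tail a) i) x
    + ∑ p, christoffel G i (a 0) p x * T x (Fin.tail a) p
    - ∑ s, ∑ p, christoffel G p (a 0) (Fin.tail a s) x * T x (Function.update (Fin.tail a) s p) i

/-- The components of the `j`-th covariant derivative `∇ʲR` of the curvature tensor. -/
def nablaR {n : ℕ} (G : EuclideanSpace ℝ (Fin n) → Matrix (Fin n) (Fin n) ℝ) :
    (j : ℕ) → EuclideanSpace ℝ (Fin n) → (Fin (3 + j) → Fin n) → Fin n → ℝ
  | 0 => riemann G
  | j + 1 => covDeriv G (nablaR G j)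

/-! ### Riemannian manifolds -/

variable {n : ℕ} {N : Type*} [TopologicalSpace N] [ChartedSpace (EuclideanSpace ℝ (Fin n)) N]
  [IsManifold (𝓡 n) ∞ N]

/-- A smooth Riemannian metric on the manifold `N`. -/
abbrev Metric (n : ℕ) (N : Type*) [TopologicalSpace N]
    [ChartedSpace (EuclideanSpace ℝ (Fin n)) N] [IsManifold (𝓡 n) ∞ N] :=
  Bundle.ContMDiffRiemannianMetric (𝓡 n) ∞ (EuclideanSpace ℝ (Fin n))
    (fun p : N => TangentSpace (𝓡 n) p)

/-- The components `h(∂ᵢφ, ∂ⱼφ)` of the metric in the parametrization `φ`. -/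
def metricComp (h : Metric n N) (φ : EuclideanSpace ℝ (Fin n) → N)
    (x : EuclideanSpace ℝ (Fin n)) : Matrix (Fin n) (Fin n) ℝ :=
  Matrix.of fun i j => h.inner (φ x)
    (mfderiv 𝓘(ℝ, EuclideanSpace ℝ (Fin n)) (𝓡 n) φ x (EuclideanSpace.single i (1 : ℝ)))
    (mfderiv 𝓘(ℝ, EuclideanSpace ℝ (Fin n)) (𝓡 n) φ x (EuclideanSpace.single j (1 : ℝ)))

/-- The components of a tangent vector in the chart `χ`. -/
def vecComp (χ : OpenPartialHomeomorph N (EuclideanSpace ℝ (Fin n))) (p : N)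
    (v : TangentSpace (𝓡 n) p) (i : Fin n) : ℝ :=
  (show EuclideanSpace ℝ (Fin n) from mfderiv (𝓡 n) 𝓘(ℝ, EuclideanSpace ℝ (Fin n)) χ p v) i

/-- The velocity of a curve. -/
def velocity (c : ℝ → N) (t : ℝ) : TangentSpace (𝓡 n) (c t) :=
  mfderiv 𝓘(ℝ, ℝ) (𝓡 n) c t (1 : ℝ)

/-- The vector field `V` along the curve `c` is parallel on the set `J` of parameters: in every
chart of the smooth structure, `(Vᵏ)' + Γᵏᵢⱼ ċⁱ Vʲ = 0`. -/
def IsParallelOn (h : Metric n N) (c : ℝ → N) (V : (t : ℝ) → TangentSpace (𝓡 n) (c t))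
    (J : Set ℝ) : Prop :=
  ∀ t ∈ J, ∀ χ ∈ IsManifold.maximalAtlas (𝓡 n) ∞ N, c t ∈ χ.source → ∀ k : Fin n,
    HasDerivAt (fun s => vecComp χ (c s) (V s) k)
      (-∑ i, ∑ j, christoffel (metricComp h χ.symm) k i j (χ (c t)) *
        vecComp χ (c t) (velocity c t) i * vecComp χ (c t) (V t) j) t

/-- The curve `c` is a geodesic (smooth, with parallel velocity) on the open set `J` of
parameters. -/
def IsGeodesicOn (h : Metric n N) (c : ℝ → N) (J : Set ℝ) : Prop :=
  ContMDiffOn 𝓘(ℝ, ℝ) (𝓡 n) ∞ c J ∧ IsParallelOn h c (velocity c) J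

/-- `(N, h)` is locally symmetric along `γ`: the tensors `∇_{γ̇} ∇ʲR`, for all `j ≥ 0`, vanish at the
points of `γ`, that is, their components `γ̇ᵇ (∇ʲ⁺¹R)ⁱ_{b a₀ a₁ …}` in the charts of the smooth
structure do. -/
def IsLocallySymmetricAlong (h : Metric n N) (γ : ℝ → N) : Prop :=
  ∀ (j : ℕ) (t : ℝ), ∀ χ ∈ IsManifold.maximalAtlas (𝓡 n) ∞ N, γ t ∈ χ.source →
    ∀ (a : Fin (3 + j) → Fin n) (i : Fin n),
      ∑ b, vecComp χ (γ t) (velocity γ t) b *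
        nablaR (metricComp h χ.symm) (j + 1) (χ (γ t))
          (Fin.cons (α := fun _ : Fin (3 + j + 1) => Fin n) b a) i = 0

/-! ### Geodesic normal coordinates along a geodesic -/

/-- The point `(t, 0, …, 0)`; it corresponds to `γ(t)`. -/
def axis [NeZero n] (t : ℝ) : EuclideanSpace ℝ (Fin n) := EuclideanSpace.single 0 t

/-- The point `(x¹, s x², …, s xⁿ)`. -/
def scaleTransversal [NeZero n] (s : ℝ) (x : EuclideanSpace ℝ (Fin n)) :
    EuclideanSpace ℝ (Fin n) :=
  WithLp.toLp 2 fun i => if i = 0 then x i else s * x i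

/-- `e` is an orthonormal frame along `γ` with first vector `γ̇` (in particular `γ` is parametrized by
arc-length), orthonormal at `γ(0)` and transported along `γ` by parallel transport. -/
structure IsParallelFrame [NeZero n] (h : Metric n N) (γ : ℝ → N)
    (e : Fin n → (t : ℝ) → TangentSpace (𝓡 n) (γ t)) : Prop where
  first : ∀ t, e 0 t = velocity γ t
  orthonormal : ∀ i j, h.inner (γ 0) (e i 0) (e j 0) = if i = j then 1 else 0
  parallel : ∀ i, IsParallelOn h γ (e i) Set.univ

/-- `σ`, on a neighbourhood `U` of the axis, is the smooth parametrization
`σ(x¹, x̂) = exp_{γ(x¹)} (∑_{j ≥ 2} xʲ eⱼ(x¹))` by geodesic normal coordinates around `γ`: for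
`x ∈ U`, the curve `s ↦ σ(x¹, s x̂)` is the geodesic which starts at `s = 0` from `γ(x¹)` with the
velocity `∑_{j ≥ 2} xʲ eⱼ(x¹)`. (At the points of the axis the differential of `σ` maps the
standard basis to `e`, so `σ` is a local diffeomorphism there.) -/
structure IsGeodesicNormalCoordinates [NeZero n] (h : Metric n N) (γ : ℝ → N)
    (e : Fin n → (t : ℝ) → TangentSpace (𝓡 n) (γ t))
    (U : Set (EuclideanSpace ℝ (Fin n))) (σ : EuclideanSpace ℝ (Fin n) → N) : Prop where
  isOpen : IsOpen U
  axis_mem : ∀ t : ℝ, axis t ∈ U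
  star : ∀ x ∈ U, ∀ s ∈ Set.Icc (0 : ℝ) 1, scaleTransversal s x ∈ U
  smooth : ContMDiffOn 𝓘(ℝ, EuclideanSpace ℝ (Fin n)) (𝓡 n) ∞ σ U
  geodesic : ∀ x ∈ U, IsGeodesicOn h (fun s : ℝ => σ (scaleTransversal s x))
    {s : ℝ | scaleTransversal s x ∈ U}
  initial : ∀ x ∈ U,
    (⟨σ (scaleTransversal 0 x), velocity (fun s : ℝ => σ (scaleTransversal s x)) 0⟩ :
      TangentBundle (𝓡 n) N) =
    ⟨γ (x 0), ∑ j ∈ Finset.univ.filter (· ≠ (0 : Fin n)), x j • e j (x 0)⟩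

end GeodesicCoords

end

/-! Write $G$ for the metric components in the coordinates $\sigma$, with index $0$ for the axis
direction. The statement reduces to two facts on the axis, $G=1$ and $\Gamma=0$, together with
$\nabla_0R=0$ there; `IsFlatToFirstOrder` collects them.

Geometry. The differential of $\sigma$ at an axis point sends the standard basis to the frame $e$,
which is orthonormal along all of $\gamma$ because parallel transport is isometric. Hence $G=1$ on
the axis, and by the inverse function theorem $\sigma$ is locally the inverse of a chart. In that
chart the frame has constant components, so parallelism gives $\Gamma^i_{0k}=0$; the transversal
geodesics are straight segments, so $\Gamma^i_{jk}w^jw^k=0$ for transversal $w$, and polarization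
gives the remaining symbols.

Calculus. A function vanishing on the axis has vanishing $\partial_0$-derivatives there, so $q=0$
suffices. As $\Gamma=0$ on the axis, $\nabla_0R=0$ reads $\partial_0R^i{}_{j0k}=0$, that is
$\partial_0\partial_j\Gamma^i_{0k}=\partial_0^2\Gamma^i_{jk}=0$ (`pd_zero_pd_christoffel`); only
$\nabla_{\dot\gamma}R=0$ is needed. For $\Gamma^0_{00}$ the source is
$\partial_kG_{00}=2\sum_iG_{0i}\Gamma^i_{0k}$. On the axis it yields
$\partial_j\partial_kG_{00}=2\partial_j\Gamma^0_{0k}$ and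
$\partial_j\partial_k\partial_0G_{00}=2\partial_j\partial_k\Gamma^0_{00}$. Commuting $\partial_0$ to
the front turns the second into $\partial_0(2\partial_j\Gamma^0_{0k})=0$ (`pd_pd_christoffel_axis`).
-/

namespace GeodesicCoords

/-! ### Partial derivatives and functions vanishing on the axis -/

section Calculus

variable {n : ℕ} {f g : EuclideanSpace ℝ (Fin n) → ℝ} {W : Set (EuclideanSpace ℝ (Fin n))}
  {x : EuclideanSpace ℝ (Fin n)}

lemma pd_congr (h : f =ᶠ[𝓝 x] g) (i : Fin n) : pd i f x = pd i g x := by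
  simp only [pd, h.fderiv_eq]

lemma pd_congr_of_eqOn (hW : IsOpen W) (h : Set.EqOn f g W) (hx : x ∈ W) (i : Fin n) :
    pd i f x = pd i g x :=
  pd_congr (h.eventuallyEq_of_mem (hW.mem_nhds hx)) i

lemma contDiffOn_pd (hW : IsOpen W) (hf : ContDiffOn ℝ ∞ f W) (i : Fin n) :
    ContDiffOn ℝ ∞ (pd i f) W :=
  (hf.fderiv_of_isOpen hW (m := ∞) (by simp)).clm_apply contDiffOn_const

lemma differentiableAt_of_smoothOn (hW : IsOpen W) (hf : ContDiffOn ℝ ∞ f W) (hx : x ∈ W) :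
    DifferentiableAt ℝ f x :=
  (hf.contDiffAt (hW.mem_nhds hx)).differentiableAt (by simp)

lemma pd_add (hf : DifferentiableAt ℝ f x) (hg : DifferentiableAt ℝ g x) (i : Fin n) :
    pd i (fun y => f y + g y) x = pd i f x + pd i g x := by
  simp only [pd, fderiv_fun_add hf hg, add_apply]

lemma pd_sub (hf : DifferentiableAt ℝ f x) (hg : DifferentiableAt ℝ g x) (i : Fin n) :
    pd i (fun y => f y - g y) x = pd i f x - pd i g x := by
  simp only [pd, fderiv_fun_sub hf hg, sub_apply]

lemma pd_mul (hf : DifferentiableAt ℝ f x) (hg : DifferentiableAt ℝ g x) (i : Fin n) :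
    pd i (fun y => f y * g y) x = f x * pd i g x + pd i f x * g x := by
  simp only [pd, fderiv_fun_mul hf hg, add_apply, smul_apply, smul_eq_mul]
  ring

lemma pd_const_mul (hf : DifferentiableAt ℝ f x) (c : ℝ) (i : Fin n) :
    pd i (fun y => c * f y) x = c * pd i f x := by
  simp only [pd, fderiv_const_mul hf, smul_apply, smul_eq_mul]

lemma pd_sum {ι : Type*} {s : Finset ι} {F : ι → EuclideanSpace ℝ (Fin n) → ℝ}
    (hF : ∀ m ∈ s, DifferentiableAt ℝ (F m) x) (i : Fin n) :
    pd i (fun y => ∑ m ∈ s, F m y) x = ∑ m ∈ s, pd i (F m) x := by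
  simp only [pd, fderiv_fun_sum hF, sum_apply]

lemma pd_comm (hf : ContDiffAt ℝ ∞ f x) (i j : Fin n) : pd i (pd j f) x = pd j (pd i f) x := by
  have hs : IsSymmSndFDerivAt ℝ f x := hf.isSymmSndFDerivAt (by
    rw [minSmoothness_of_isRCLikeNormedField]
    exact WithTop.coe_le_coe.2 le_top)
  have hd : DifferentiableAt ℝ (fderiv ℝ f) x :=
    (hf.fderiv_right (m := 1) (by norm_cast)).differentiableAt (by simp)
  have key (a b : Fin n) : pd a (pd b f) x
      = fderiv ℝ (fderiv ℝ f) x (EuclideanSpace.single a 1) (EuclideanSpace.single b 1) := by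
    unfold pd
    rw [fderiv_clm_apply hd (differentiableAt_const _)]
    simp
  rw [key, key, hs]

lemma hasDerivAt_axis [NeZero n] (t : ℝ) :
    HasDerivAt (axis (n := n)) (EuclideanSpace.single 0 1) t := by
  have h : (axis (n := n)) = fun s : ℝ => s • EuclideanSpace.single 0 (1 : ℝ) := by
    funext s
    ext i
    simp [axis]
  rw [h]
  simpa using (hasDerivAt_id t).smul_const (EuclideanSpace.single (0 : Fin n) (1 : ℝ))

lemma pd_zero_axis [NeZero n] (hv : ∀ t, f (axis t) = 0) {t : ℝ}
    (hf : DifferentiableAt ℝ f (axis t)) : pd 0 f (axis t) = 0 := by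
  have h := hf.hasFDerivAt.comp_hasDerivAt t (hasDerivAt_axis t)
  have h0 : f ∘ axis = fun _ => (0 : ℝ) := funext hv
  rw [h0] at h
  exact h.unique (hasDerivAt_const t 0)

/-- The iterated derivatives along the axis of a function vanishing on the axis vanish there. -/
lemma iterate_pd_zero_axis [NeZero n] (hW : IsOpen W) (hax : ∀ t, axis t ∈ W)
    (hf : ContDiffOn ℝ ∞ f W) (hv : ∀ t, f (axis t) = 0) (q : ℕ) (t : ℝ) :
    (pd 0)^[q] f (axis t) = 0 := by
  induction q generalizing f t with
  | zero => exact hv t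
  | succ q ih =>
    rw [Function.iterate_succ_apply]
    exact ih (contDiffOn_pd hW hf 0)
      (fun s => pd_zero_axis hv (differentiableAt_of_smoothOn hW hf (hax s))) t

end Calculus

/-! ### Christoffel symbols: locality, metric compatibility, smoothness -/

section Christoffel

variable {n : ℕ} {G G' : EuclideanSpace ℝ (Fin n) → Matrix (Fin n) (Fin n) ℝ}
  {W : Set (EuclideanSpace ℝ (Fin n))} {x : EuclideanSpace ℝ (Fin n)}

/-- Christoffel symbols, curvature and its covariant derivative depend only on the germ of the
metric. This carries equations known in a chart over to $\sigma$, with which the inverse chart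
agrees only locally. -/
lemma christoffel_eventuallyEq (h : G =ᶠ[𝓝 x] G') (i j k : Fin n) :
    christoffel G i j k =ᶠ[𝓝 x] christoffel G' i j k := by
  filter_upwards [h.eventuallyEq_nhds] with y hy
  have e (a b : Fin n) : (fun z => G z a b) =ᶠ[𝓝 y] fun z => G' z a b :=
    hy.mono fun z hz => by simp only [hz]
  simp only [christoffel, hy.self_of_nhds, pd_congr (e _ _)]

lemma riemann_eventuallyEq (h : G =ᶠ[𝓝 x] G') (a : Fin 3 → Fin n) (i : Fin n) :
    (fun y => riemann G y a i) =ᶠ[𝓝 x] fun y => riemann G' y a i := by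
  filter_upwards [h.eventuallyEq_nhds] with y hy
  simp only [riemann, pd_congr (christoffel_eventuallyEq hy _ _ _),
    (christoffel_eventuallyEq hy _ _ _).self_of_nhds]

lemma covDeriv_riemann_congr (h : G =ᶠ[𝓝 x] G') (a : Fin 4 → Fin n) (i : Fin n) :
    covDeriv G (riemann G) x a i = covDeriv G' (riemann G') x a i := by
  simp only [covDeriv, pd_congr (riemann_eventuallyEq h _ _),
    (riemann_eventuallyEq h _ _).self_of_nhds, (christoffel_eventuallyEq h _ _ _).self_of_nhds]

lemma christoffel_symm (hs : ∀ y a b, G y a b = G y b a) (i j k : Fin n) :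
    christoffel G i j k x = christoffel G i k j x := by
  unfold christoffel
  congr 1
  refine Finset.sum_congr rfl fun l _ => ?_
  have e : (fun y => G y j k) = fun y => G y k j := funext fun y => hs y j k
  rw [e]
  ring

/-- The Christoffel symbols of the first kind. -/
lemma sum_mul_christoffel (hdet : IsUnit (G x).det) (m j k : Fin n) :
    ∑ i, G x m i * christoffel G i j k x = (1 / 2 : ℝ) *
      (pd j (fun y => G y k m) x + pd k (fun y => G y j m) x - pd m (fun y => G y j k) x) := by
  set L : Fin n → ℝ := fun l =>
    pd j (fun y => G y k l) x + pd k (fun y => G y j l) x - pd l (fun y => G y j k) x with hL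
  have h1 : (fun i => christoffel G i j k x) = (1 / 2 : ℝ) • (G x)⁻¹.mulVec L := by
    funext i
    simp [christoffel, Matrix.mulVec, dotProduct, hL]
  have h2 : ∑ i, G x m i * christoffel G i j k x
      = (G x).mulVec (fun i => christoffel G i j k x) m := rfl
  rw [h2, h1, Matrix.mulVec_smul, Matrix.mulVec_mulVec, Matrix.mul_nonsing_inv _ hdet]
  simp [hL]

/-- Metric compatibility of the Levi-Civita connection. -/
lemma pd_metric (hs : ∀ y a b, G y a b = G y b a) (hdet : IsUnit (G x).det) (c a b : Fin n) :
    pd c (fun y => G y a b) x = ∑ i, G x a i * christoffel G i c b x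
      + ∑ i, G x b i * christoffel G i c a x := by
  rw [sum_mul_christoffel hdet, sum_mul_christoffel hdet]
  have e (a b : Fin n) : (fun y => G y a b) = fun y => G y b a := funext fun y => hs y a b
  rw [e b a, e c a, e c b]
  ring

lemma contDiffOn_det (hG : ∀ a b, ContDiffOn ℝ ∞ (fun y => G y a b) W) :
    ContDiffOn ℝ ∞ (fun y => (G y).det) W := by
  simp only [Matrix.det_apply']
  exact ContDiffOn.sum fun τ _ => contDiffOn_const.mul (contDiffOn_prod fun a _ => hG _ _)

lemma contDiffOn_inv (hG : ∀ a b, ContDiffOn ℝ ∞ (fun y => G y a b) W)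
    (hdet : ∀ y ∈ W, IsUnit (G y).det) (i j : Fin n) :
    ContDiffOn ℝ ∞ (fun y => (G y)⁻¹ i j) W := by
  have e : (fun y => (G y)⁻¹ i j) = fun y => ((G y).det)⁻¹ * (G y).adjugate i j := by
    funext y
    simp [Matrix.inv_def]
  rw [e]
  refine ((contDiffOn_det hG).inv fun y hy => (hdet y hy).ne_zero).mul ?_
  -- The entries of the adjugate are determinants of $G$ with one row replaced by a constant one.
  simp only [Matrix.adjugate_apply]
  refine contDiffOn_det fun a b => ?_
  simp only [Matrix.updateRow_apply]
  split_ifs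
  · exact contDiffOn_const
  · exact hG a b

lemma contDiffOn_christoffel (hW : IsOpen W) (hG : ∀ a b, ContDiffOn ℝ ∞ (fun y => G y a b) W)
    (hdet : ∀ y ∈ W, IsUnit (G y).det) (i j k : Fin n) :
    ContDiffOn ℝ ∞ (christoffel G i j k) W := by
  unfold christoffel
  refine contDiffOn_const.mul (ContDiffOn.sum fun l _ => (contDiffOn_inv hG hdet i l).mul ?_)
  exact ((contDiffOn_pd hW (hG _ _) _).add (contDiffOn_pd hW (hG _ _) _)).sub
    (contDiffOn_pd hW (hG _ _) _)

end Christoffel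

/-! ### Consequences of first-order flatness and parallel curvature on the axis -/

section Axis

variable {n : ℕ} [NeZero n] {G : EuclideanSpace ℝ (Fin n) → Matrix (Fin n) (Fin n) ℝ}
  {W : Set (EuclideanSpace ℝ (Fin n))}

/-- The metric components `G`, smooth on a neighbourhood `W` of the axis, are Euclidean to first
order along the axis, and their curvature tensor is parallel along it. -/
structure IsFlatToFirstOrder (G : EuclideanSpace ℝ (Fin n) → Matrix (Fin n) (Fin n) ℝ)
    (W : Set (EuclideanSpace ℝ (Fin n))) : Prop where
  isOpen : IsOpen W
  axis_mem : ∀ t : ℝ, axis t ∈ W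
  smooth : ∀ a b, ContDiffOn ℝ ∞ (fun y => G y a b) W
  symm : ∀ y a b, G y a b = G y b a
  det : ∀ y ∈ W, IsUnit (G y).det
  eq_one : ∀ t, G (axis t) = 1
  christoffel_axis : ∀ i j k t, christoffel G i j k (axis t) = 0
  covDeriv_axis : ∀ t (a : Fin 3 → Fin n) i,
    covDeriv G (riemann G) (axis t) (Fin.cons (α := fun _ : Fin 4 => Fin n) 0 a) i = 0

namespace IsFlatToFirstOrder

variable (hG : IsFlatToFirstOrder G W)

include hG

lemma smooth_christoffel (i j k : Fin n) : ContDiffOn ℝ ∞ (christoffel G i j k) W :=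
  contDiffOn_christoffel hG.isOpen hG.smooth hG.det i j k

lemma pd_metric_axis (c a b : Fin n) (t : ℝ) : pd c (fun y => G y a b) (axis t) = 0 := by
  rw [pd_metric hG.symm (hG.det _ (hG.axis_mem t))]
  simp [hG.christoffel_axis]

/-- The product rule at a zero of the Christoffel symbol. -/
lemma pd_mul_christoffel {f : EuclideanSpace ℝ (Fin n) → ℝ} {t : ℝ}
    (hf : DifferentiableAt ℝ f (axis t)) (c i j k : Fin n) :
    pd c (fun y => f y * christoffel G i j k y) (axis t)
      = f (axis t) * pd c (christoffel G i j k) (axis t) := by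
  rw [pd_mul hf (differentiableAt_of_smoothOn hG.isOpen (hG.smooth_christoffel i j k)
    (hG.axis_mem t)), hG.christoffel_axis]
  ring

/-- Each quadratic term of the curvature is a product of two factors vanishing on the axis, so its
first derivatives vanish there too and only the linear part of $\partial_0R$ survives. -/
lemma pd_zero_pd_christoffel (i j k : Fin n) (t : ℝ) :
    pd 0 (pd j (christoffel G i 0 k)) (axis t) = 0 := by
  have hd {f : EuclideanSpace ℝ (Fin n) → ℝ} (hf : ContDiffOn ℝ ∞ f W) :
      DifferentiableAt ℝ f (axis t) := differentiableAt_of_smoothOn hG.isOpen hf (hG.axis_mem t)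
  have hC := hG.smooth_christoffel
  -- These indices select $R^i{}_{j0k}=\partial_j\Gamma^i_{0k}-\partial_0\Gamma^i_{jk}+\dots$; the
  -- second term is then killed by $\partial_0^2\Gamma^i_{jk}=0$.
  have h := hG.covDeriv_axis t ![j, 0, k] i
  simp only [covDeriv, hG.christoffel_axis, zero_mul, Finset.sum_const_zero, add_zero, sub_zero,
    Fin.cons_zero, Fin.tail_cons] at h
  simp only [riemann, Matrix.cons_val_zero, Matrix.cons_val_one, Matrix.cons_val] at h
  have hp (a b c d e f : Fin n) :
      ContDiffOn ℝ ∞ (fun y => christoffel G a b c y * christoffel G d e f y) W :=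
    (hC a b c).mul (hC d e f)
  have hpp (a b c d e f : Fin n) :
      pd 0 (fun y => christoffel G a b c y * christoffel G d e f y) (axis t) = 0 := by
    rw [hG.pd_mul_christoffel (hd (hC a b c)), hG.christoffel_axis, zero_mul]
  rw [pd_add (hd ((contDiffOn_pd hG.isOpen (hC _ _ _) _).sub
      (contDiffOn_pd hG.isOpen (hC _ _ _) _)))
      (hd (ContDiffOn.sum fun m _ => (hp _ _ _ _ _ _).sub (hp _ _ _ _ _ _))),
    pd_sub (hd (contDiffOn_pd hG.isOpen (hC _ _ _) _)) (hd (contDiffOn_pd hG.isOpen (hC _ _ _) _)),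
    pd_sum (fun m _ => hd ((hp _ _ _ _ _ _).sub (hp _ _ _ _ _ _)))] at h
  simp only [pd_sub (hd (hp _ _ _ _ _ _)) (hd (hp _ _ _ _ _ _)), hpp, sub_zero,
    Finset.sum_const_zero, add_zero] at h
  have h2 := iterate_pd_zero_axis hG.isOpen hG.axis_mem (hC i j k) (hG.christoffel_axis i j k) 2 t
  simp only [Function.iterate_succ_apply, Function.iterate_zero, id_eq] at h2
  linarith

lemma pd_metric_zero_zero (k : Fin n) {y : EuclideanSpace ℝ (Fin n)} (hy : y ∈ W) :
    pd k (fun z => G z 0 0) y = 2 * ∑ i, G y 0 i * christoffel G i 0 k y := by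
  rw [pd_metric hG.symm (hG.det y hy)]
  simp only [christoffel_symm hG.symm _ k 0]
  ring

/-- On the axis the metric is the identity, so lowering an index commutes with `pd`. -/
lemma pd_sum_metric_mul_christoffel (c j k : Fin n) (t : ℝ) :
    pd c (fun y => 2 * ∑ i, G y 0 i * christoffel G i j k y) (axis t)
      = 2 * pd c (christoffel G 0 j k) (axis t) := by
  have hd {f : EuclideanSpace ℝ (Fin n) → ℝ} (hf : ContDiffOn ℝ ∞ f W) :
      DifferentiableAt ℝ f (axis t) := differentiableAt_of_smoothOn hG.isOpen hf (hG.axis_mem t)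
  have hp (i : Fin n) := (hG.smooth 0 i).mul (hG.smooth_christoffel i j k)
  rw [pd_const_mul (hd (ContDiffOn.sum fun i _ => hp i)), pd_sum fun i _ => hd (hp i)]
  simp only [hG.pd_mul_christoffel (hd (hG.smooth 0 _)), hG.eq_one, Matrix.one_apply]
  simp

lemma pd_pd_metric_axis (j k : Fin n) (t : ℝ) :
    pd j (pd k (fun z => G z 0 0)) (axis t) = 2 * pd j (christoffel G 0 0 k) (axis t) := by
  rw [pd_congr_of_eqOn hG.isOpen (fun y hy => hG.pd_metric_zero_zero k hy) (hG.axis_mem t),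
    hG.pd_sum_metric_mul_christoffel]

/-- On the axis $2\partial_k\Gamma^0_{00}=\partial_k\partial_0G_{00}=\partial_0\partial_kG_{00}$,
and $\partial_kG_{00}$ vanishes along the axis. -/
lemma pd_christoffel_axis (k : Fin n) (t : ℝ) : pd k (christoffel G 0 0 0) (axis t) = 0 := by
  have h := hG.pd_pd_metric_axis k 0 t
  rw [pd_comm ((hG.smooth 0 0).contDiffAt (hG.isOpen.mem_nhds (hG.axis_mem t))),
    pd_zero_axis (fun s => hG.pd_metric_axis k 0 0 s) (differentiableAt_of_smoothOn hG.isOpen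
      (contDiffOn_pd hG.isOpen (hG.smooth 0 0) k) (hG.axis_mem t))] at h
  linarith

/-- In the second-order product rule every other term contains an undifferentiated $\Gamma$ or a
first derivative of $G$, and both vanish on the axis. -/
lemma pd_pd_sum_metric_mul_christoffel (j k : Fin n) (t : ℝ) :
    pd j (pd k (fun y => 2 * ∑ i, G y 0 i * christoffel G i 0 0 y)) (axis t)
      = 2 * pd j (pd k (christoffel G 0 0 0)) (axis t) := by
  have hd {f : EuclideanSpace ℝ (Fin n) → ℝ} {y : EuclideanSpace ℝ (Fin n)} (hy : y ∈ W)
      (hf : ContDiffOn ℝ ∞ f W) :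
      DifferentiableAt ℝ f y := differentiableAt_of_smoothOn hG.isOpen hf hy
  have hC := hG.smooth_christoffel
  have hp (i : Fin n) := (hG.smooth 0 i).mul (hC i 0 0)
  -- The first derivative is computed on all of $W$, since it is differentiated again in a direction
  -- that may leave the axis.
  have e : Set.EqOn (pd k (fun y => 2 * ∑ i, G y 0 i * christoffel G i 0 0 y))
      (fun y => 2 * ∑ i, (G y 0 i * pd k (christoffel G i 0 0) y
        + pd k (fun z => G z 0 i) y * christoffel G i 0 0 y)) W := by
    intro y hy
    rw [pd_const_mul (hd hy (ContDiffOn.sum fun i _ => hp i)), pd_sum fun i _ => hd hy (hp i)]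
    simp only [pd_mul (hd hy (hG.smooth 0 _)) (hd hy (hC _ 0 0))]
  have h1 (i : Fin n) := (hG.smooth 0 i).mul (contDiffOn_pd hG.isOpen (hC i 0 0) k)
  have h2 (i : Fin n) := (contDiffOn_pd hG.isOpen (hG.smooth 0 i) k).mul (hC i 0 0)
  have ht := hG.axis_mem t
  rw [pd_congr_of_eqOn hG.isOpen e ht,
    pd_const_mul (hd ht (ContDiffOn.sum fun i _ => (h1 i).add (h2 i))),
    pd_sum fun i _ => hd ht ((h1 i).add (h2 i))]
  have h3 (i : Fin n) : pd j (fun y => G y 0 i * pd k (christoffel G i 0 0) y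
        + pd k (fun z => G z 0 i) y * christoffel G i 0 0 y) (axis t)
      = (if (0 : Fin n) = i then 1 else 0) * pd j (pd k (christoffel G i 0 0)) (axis t) := by
    rw [pd_add (hd ht (h1 i)) (hd ht (h2 i)),
      pd_mul (hd ht (hG.smooth 0 i)) (hd ht (contDiffOn_pd hG.isOpen (hC i 0 0) k)),
      hG.pd_mul_christoffel (hd ht (contDiffOn_pd hG.isOpen (hG.smooth 0 i) k)),
      hG.pd_metric_axis, hG.pd_metric_axis, hG.eq_one, Matrix.one_apply]
    ring
  simp only [h3]
  simp

/-- The third derivative $\partial_j\partial_k\partial_0G_{00}$ is evaluated twice: as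
$2\partial_j\partial_k\Gamma^0_{00}$, and, with $\partial_0$ outermost, as
$2\partial_0\partial_j\Gamma^0_{0k}=0$. -/
lemma pd_pd_christoffel_axis (j k : Fin n) (t : ℝ) :
    pd j (pd k (christoffel G 0 0 0)) (axis t) = 0 := by
  have hO := hG.isOpen
  have hg := hG.smooth 0 0
  have hd {f : EuclideanSpace ℝ (Fin n) → ℝ} (hf : ContDiffOn ℝ ∞ f W) :
      DifferentiableAt ℝ f (axis t) := differentiableAt_of_smoothOn hO hf (hG.axis_mem t)
  have h := hG.pd_pd_sum_metric_mul_christoffel j k t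
  have e1 : Set.EqOn (pd k (fun y => 2 * ∑ i, G y 0 i * christoffel G i 0 0 y))
      (pd 0 (pd k (fun z => G z 0 0))) W := fun y hy => by
    rw [pd_comm (hg.contDiffAt (hO.mem_nhds hy))]
    exact (pd_congr_of_eqOn hO (fun z hz => hG.pd_metric_zero_zero 0 hz) hy k).symm
  rw [pd_congr_of_eqOn hO e1 (hG.axis_mem t),
    pd_comm ((contDiffOn_pd hO hg k).contDiffAt (hO.mem_nhds (hG.axis_mem t)))] at h
  have hjk := contDiffOn_pd hO (contDiffOn_pd hO hg k) j
  have hCj := contDiffOn_pd hO (hG.smooth_christoffel 0 0 k) j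
  -- The identity $\partial_j\partial_kG_{00}=2\partial_j\Gamma^0_{0k}$ holds only on the axis,
  -- which is enough to differentiate it by $\partial_0$.
  have h0 := pd_zero_axis (f := fun y => pd j (pd k (fun z => G z 0 0)) y
      - 2 * pd j (christoffel G 0 0 k) y)
    (fun s => by rw [hG.pd_pd_metric_axis, sub_self]) (t := t) (hd (hjk.sub (contDiffOn_const.mul hCj)))
  rw [pd_sub (hd hjk) (hd (contDiffOn_const.mul hCj)), pd_const_mul (hd hCj),
    hG.pd_zero_pd_christoffel] at h0
  linarith

end IsFlatToFirstOrder

end Axis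

end GeodesicCoords

noncomputable section

namespace GeodesicCoords

variable {n : ℕ} {N : Type*} [TopologicalSpace N] [ChartedSpace (EuclideanSpace ℝ (Fin n)) N]
  [IsManifold (𝓡 n) ∞ N]

/-! ### Differentials, metric components and velocities -/

section Differential

/-- The differential of a parametrization, the tangent spaces of `N` being copies of the space of
coordinates. -/
def differential (φ : EuclideanSpace ℝ (Fin n) → N) (x : EuclideanSpace ℝ (Fin n)) :
    EuclideanSpace ℝ (Fin n) →L[ℝ] EuclideanSpace ℝ (Fin n) :=
  mfderiv 𝓘(ℝ, EuclideanSpace ℝ (Fin n)) (𝓡 n) φ x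

/-- The differential of a chart, the tangent spaces of `N` being copies of the space of
coordinates. -/
def chartDifferential (χ : OpenPartialHomeomorph N (EuclideanSpace ℝ (Fin n))) (p : N) :
    EuclideanSpace ℝ (Fin n) →L[ℝ] EuclideanSpace ℝ (Fin n) :=
  mfderiv (𝓡 n) 𝓘(ℝ, EuclideanSpace ℝ (Fin n)) χ p

/-- The scalar product at `p`, as a bilinear form on the space of coordinates. -/
def innerAt (h : Metric n N) (p : N) :
    EuclideanSpace ℝ (Fin n) →L[ℝ] EuclideanSpace ℝ (Fin n) →L[ℝ] ℝ :=
  h.inner p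

/-- The velocity of a curve, as an element of the space of coordinates. -/
def velocityVec (c : ℝ → N) (t : ℝ) : EuclideanSpace ℝ (Fin n) := velocity c t

omit [IsManifold (𝓡 n) ∞ N] in
lemma vecComp_eq (χ : OpenPartialHomeomorph N (EuclideanSpace ℝ (Fin n))) (p : N)
    (v : TangentSpace (𝓡 n) p) (i : Fin n) : vecComp χ p v i = chartDifferential χ p v i := rfl

lemma metricComp_apply (h : Metric n N) (φ : EuclideanSpace ℝ (Fin n) → N)
    (x : EuclideanSpace ℝ (Fin n)) (i j : Fin n) :
    metricComp h φ x i j = innerAt h (φ x) (differential φ x (EuclideanSpace.single i 1))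
      (differential φ x (EuclideanSpace.single j 1)) := rfl

lemma innerAt_pos (h : Metric n N) (p : N) {v : EuclideanSpace ℝ (Fin n)} (hv : v ≠ 0) :
    0 < innerAt h p v v := h.pos p v hv

lemma metricComp_symm (h : Metric n N) (φ : EuclideanSpace ℝ (Fin n) → N)
    (x : EuclideanSpace ℝ (Fin n)) (i j : Fin n) : metricComp h φ x i j = metricComp h φ x j i :=
  h.symm _ _ _

omit [IsManifold (𝓡 n) ∞ N] in
lemma differential_congr {φ φ' : EuclideanSpace ℝ (Fin n) → N} {x : EuclideanSpace ℝ (Fin n)}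
    (hφ : φ =ᶠ[𝓝 x] φ') : differential φ x = differential φ' x :=
  hφ.mfderiv_eq

lemma metricComp_eventuallyEq (h : Metric n N) {φ φ' : EuclideanSpace ℝ (Fin n) → N}
    {x : EuclideanSpace ℝ (Fin n)} (hφ : φ =ᶠ[𝓝 x] φ') :
    metricComp h φ =ᶠ[𝓝 x] metricComp h φ' := by
  filter_upwards [hφ.eventuallyEq_nhds] with y hy
  ext i j
  rw [metricComp_apply, metricComp_apply, differential_congr hy, hy.self_of_nhds]

lemma sum_metricComp (h : Metric n N) (φ : EuclideanSpace ℝ (Fin n) → N)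
    (x v w : EuclideanSpace ℝ (Fin n)) :
    innerAt h (φ x) (differential φ x v) (differential φ x w)
      = ∑ a, ∑ b, metricComp h φ x a b * v a * w b := by
  have e (u : EuclideanSpace ℝ (Fin n)) : u = ∑ a, u a • EuclideanSpace.single a (1 : ℝ) := by
    simpa using ((EuclideanSpace.basisFun (Fin n) ℝ).sum_repr u).symm
  conv_lhs => rw [e v, e w]
  simp only [map_sum, map_smul, sum_apply, smul_apply, smul_eq_mul, metricComp_apply,
    Finset.mul_sum]
  rw [Finset.sum_comm]
  refine Finset.sum_congr rfl fun a _ => Finset.sum_congr rfl fun b _ => ?_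
  ring

/-- A kernel vector of this Gram matrix would have an image of zero length, against positivity of
the metric and injectivity. -/
lemma isUnit_det_metricComp (h : Metric n N) {φ : EuclideanSpace ℝ (Fin n) → N}
    {x : EuclideanSpace ℝ (Fin n)} (hφ : Function.Injective (differential φ x)) :
    IsUnit (metricComp h φ x).det := by
  rw [isUnit_iff_ne_zero]
  intro h0
  obtain ⟨v, hv, hv0⟩ := Matrix.exists_mulVec_eq_zero_iff.2 h0
  set u : EuclideanSpace ℝ (Fin n) := WithLp.toLp 2 v with hu
  have hu0 : u ≠ 0 := fun h' => hv (by simpa [hu] using h')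
  have hd : differential φ x u ≠ 0 := fun h' => hu0 (hφ (by rw [h', map_zero]))
  have hpos := innerAt_pos h (φ x) hd
  rw [sum_metricComp] at hpos
  have hz : ∑ a, ∑ b, metricComp h φ x a b * u a * u b = 0 := by
    refine Finset.sum_eq_zero fun a _ => ?_
    have := congrFun hv0 a
    simp only [Matrix.mulVec, dotProduct, Pi.zero_apply] at this
    calc ∑ b, metricComp h φ x a b * u a * u b = u a * ∑ b, metricComp h φ x a b * v b := by
          rw [Finset.mul_sum]
          exact Finset.sum_congr rfl fun b _ => by simp only [hu]; ring
      _ = 0 := by rw [this, mul_zero]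
  exact hpos.ne' hz

/-- The metric is a smooth section of a bundle of bilinear forms; it is evaluated on the tangent map
of $\varphi$ applied to constant vector fields. -/
lemma contDiffOn_metricComp (h : Metric n N) {φ : EuclideanSpace ℝ (Fin n) → N}
    {V : Set (EuclideanSpace ℝ (Fin n))} (hV : IsOpen V)
    (hφ : ContMDiffOn 𝓘(ℝ, EuclideanSpace ℝ (Fin n)) (𝓡 n) ∞ φ V) (i j : Fin n) :
    ContDiffOn ℝ ∞ (fun x => metricComp h φ x i j) V := by
  have hsec (v : EuclideanSpace ℝ (Fin n)) :
      ContMDiffOn 𝓘(ℝ, EuclideanSpace ℝ (Fin n)) (𝓡 n).tangent ∞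
        (fun x => (⟨φ x, mfderiv 𝓘(ℝ, EuclideanSpace ℝ (Fin n)) (𝓡 n) φ x v⟩ :
          TangentBundle (𝓡 n) N)) V := by
    have h1 := hφ.contMDiffOn_tangentMapWithin (m := ∞) (by simp) hV.uniqueMDiffOn
    have h2 : ContMDiffOn 𝓘(ℝ, EuclideanSpace ℝ (Fin n))
        (𝓘(ℝ, EuclideanSpace ℝ (Fin n))).tangent ∞
        (fun x => (⟨x, v⟩ : TangentBundle 𝓘(ℝ, EuclideanSpace ℝ (Fin n))
          (EuclideanSpace ℝ (Fin n)))) V :=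
      contMDiffOn_vectorSpace_iff_contDiffOn.2 contDiffOn_const
    refine (h1.comp h2 fun x hx => hx).congr fun x hx => ?_
    simp only [Function.comp, tangentMapWithin, mfderivWithin_of_isOpen hV hx]
  rw [← contMDiffOn_iff_contDiffOn]
  intro x hx
  have := ContMDiffWithinAt.clm_bundle_apply₂ (F₁ := EuclideanSpace ℝ (Fin n))
    (F₂ := EuclideanSpace ℝ (Fin n)) (F₃ := ℝ) (E₃ := Bundle.Trivial N ℝ) (b := φ)
    (ψ := fun y => h.inner (φ y))
    (h.contMDiff.contMDiffAt.comp_contMDiffWithinAt x (hφ x hx))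
    (hsec (EuclideanSpace.single i 1) x hx) (hsec (EuclideanSpace.single j 1) x hx)
  rw [Bundle.contMDiffWithinAt_totalSpace] at this
  exact this.2

omit [IsManifold (𝓡 n) ∞ N] in
lemma velocityVec_comp {φ : EuclideanSpace ℝ (Fin n) → N} {c : ℝ → EuclideanSpace ℝ (Fin n)}
    {v : EuclideanSpace ℝ (Fin n)} {s : ℝ} (hc : HasDerivAt c v s)
    (hφ : MDifferentiableAt 𝓘(ℝ, EuclideanSpace ℝ (Fin n)) (𝓡 n) φ (c s)) :
    velocityVec (fun r => φ (c r)) s = differential φ (c s) v := by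
  have hc' : HasMFDerivAt 𝓘(ℝ, ℝ) 𝓘(ℝ, EuclideanSpace ℝ (Fin n)) c s
      (ContinuousLinearMap.toSpanSingleton ℝ v) := hc.hasFDerivAt.hasMFDerivAt
  have h := (hφ.hasMFDerivAt.comp s hc').mfderiv
  change mfderiv 𝓘(ℝ, ℝ) (𝓡 n) (φ ∘ c) s (1 : ℝ) = _
  rw [h]
  change mfderiv _ _ φ (c s) (ContinuousLinearMap.toSpanSingleton ℝ v 1) = _
  rw [ContinuousLinearMap.toSpanSingleton_apply_one]
  rfl

omit [IsManifold (𝓡 n) ∞ N] in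
lemma chartDifferential_differential {φ : EuclideanSpace ℝ (Fin n) → N}
    {χ : OpenPartialHomeomorph N (EuclideanSpace ℝ (Fin n))} {x : EuclideanSpace ℝ (Fin n)}
    (hχ : MDifferentiableAt (𝓡 n) 𝓘(ℝ, EuclideanSpace ℝ (Fin n)) χ (φ x))
    (hφ : MDifferentiableAt 𝓘(ℝ, EuclideanSpace ℝ (Fin n)) (𝓡 n) φ x)
    (v : EuclideanSpace ℝ (Fin n)) :
    chartDifferential χ (φ x) (differential φ x v) = fderiv ℝ (fun y => χ (φ y)) x v := by
  rw [← mfderiv_eq_fderiv]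
  exact (mfderiv_comp_apply x hχ hφ v).symm

omit [IsManifold (𝓡 n) ∞ N] in
lemma chartDifferential_velocityVec {c : ℝ → N}
    {χ : OpenPartialHomeomorph N (EuclideanSpace ℝ (Fin n))} {t : ℝ}
    (hχ : MDifferentiableAt (𝓡 n) 𝓘(ℝ, EuclideanSpace ℝ (Fin n)) χ (c t))
    (hc : MDifferentiableAt 𝓘(ℝ, ℝ) (𝓡 n) c t) :
    HasDerivAt (fun s => χ (c s)) (chartDifferential χ (c t) (velocityVec c t)) t := by
  have h : HasFDerivAt (fun s => χ (c s)) ((chartDifferential χ (c t)).comp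
      (show ℝ →L[ℝ] EuclideanSpace ℝ (Fin n) from mfderiv 𝓘(ℝ, ℝ) (𝓡 n) c t)) t :=
    hasMFDerivAt_iff_hasFDerivAt.1 (hχ.hasMFDerivAt.comp t hc.hasMFDerivAt)
  exact h.hasDerivAt

end Differential

/-! ### Charts and the inverse function theorem -/

section Charts

variable {χ : OpenPartialHomeomorph N (EuclideanSpace ℝ (Fin n))}

omit [IsManifold (𝓡 n) ∞ N] in
lemma mdifferentiableAt_chart (hχ : χ ∈ IsManifold.maximalAtlas (𝓡 n) ∞ N) {p : N}
    (hp : p ∈ χ.source) : MDifferentiableAt (𝓡 n) 𝓘(ℝ, EuclideanSpace ℝ (Fin n)) χ p :=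
  (contMDiffAt_of_mem_maximalAtlas hχ hp).mdifferentiableAt (by simp)

omit [IsManifold (𝓡 n) ∞ N] in
lemma mdifferentiableAt_chart_symm (hχ : χ ∈ IsManifold.maximalAtlas (𝓡 n) ∞ N)
    {x : EuclideanSpace ℝ (Fin n)} (hx : x ∈ χ.target) :
    MDifferentiableAt 𝓘(ℝ, EuclideanSpace ℝ (Fin n)) (𝓡 n) χ.symm x :=
  (contMDiffAt_symm_of_mem_maximalAtlas hχ hx).mdifferentiableAt (by simp)

omit [IsManifold (𝓡 n) ∞ N] in
/-- A parametrization with inverse `χ` has inverse differential. -/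
lemma chartDifferential_differential_of_eqOn (hχ : χ ∈ IsManifold.maximalAtlas (𝓡 n) ∞ N)
    {φ : EuclideanSpace ℝ (Fin n) → N} (hφ : Set.EqOn χ.symm φ χ.target)
    {x : EuclideanSpace ℝ (Fin n)} (hx : x ∈ χ.target) (v : EuclideanSpace ℝ (Fin n)) :
    chartDifferential χ (φ x) (differential φ x v) = v := by
  have he : χ.symm =ᶠ[𝓝 x] φ := hφ.eventuallyEq_of_mem (χ.open_target.mem_nhds hx)
  rw [chartDifferential_differential]
  · have : (fun y => χ (φ y)) =ᶠ[𝓝 x] id := by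
      filter_upwards [χ.open_target.mem_nhds hx] with y hy
      rw [← hφ hy, χ.right_inv hy, id]
    rw [this.fderiv_eq, fderiv_id]
    rfl
  · rw [← hφ hx]
    exact mdifferentiableAt_chart hχ (χ.map_target hx)
  · exact he.mdifferentiableAt_iff.1 (mdifferentiableAt_chart_symm hχ hx)

omit [IsManifold (𝓡 n) ∞ N] in
-- The composition in the other order is the identity; between spaces of equal finite dimension a
-- one-sided inverse is two-sided.
lemma differential_symm_chartDifferential (hχ : χ ∈ IsManifold.maximalAtlas (𝓡 n) ∞ N) {p : N}
    (hp : p ∈ χ.source) (v : EuclideanSpace ℝ (Fin n)) :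
    differential χ.symm (χ p) (chartDifferential χ p v) = v := by
  have hp' := χ.map_source hp
  have key := chartDifferential_differential_of_eqOn hχ (Set.eqOn_refl _ _) hp'
  rw [χ.left_inv hp] at key
  have h1 : Function.LeftInverse (chartDifferential χ p) (differential χ.symm (χ p)) := key
  have h2 := LinearMap.surjective_of_injective
    (f := (differential χ.symm (χ p)).toLinearMap) h1.injective
  obtain ⟨w, rfl⟩ := h2 v
  exact congrArg _ (key w)

omit [IsManifold (𝓡 n) ∞ N] in
lemma injective_differential_symm (hχ : χ ∈ IsManifold.maximalAtlas (𝓡 n) ∞ N)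
    {x : EuclideanSpace ℝ (Fin n)} (hx : x ∈ χ.target) :
    Function.Injective (differential χ.symm x) :=
  Function.LeftInverse.injective (g := chartDifferential χ (χ.symm x))
    (chartDifferential_differential_of_eqOn hχ (Set.eqOn_refl _ _) hx)

/-- The scalar product in a chart. -/
lemma innerAt_eq_sum (h : Metric n N) (hχ : χ ∈ IsManifold.maximalAtlas (𝓡 n) ∞ N) {p : N}
    (hp : p ∈ χ.source) (v w : EuclideanSpace ℝ (Fin n)) :
    innerAt h p v w = ∑ a, ∑ b, metricComp h χ.symm (χ p) a b *
      chartDifferential χ p v a * chartDifferential χ p w b := by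
  rw [← sum_metricComp, differential_symm_chartDifferential hχ hp,
    differential_symm_chartDifferential hχ hp, χ.left_inv hp]

/-- The inverse function theorem: an immersion of the space of coordinates is locally the inverse
of a chart. -/
lemma exists_chart_symm_eqOn {U : Set (EuclideanSpace ℝ (Fin n))} (hU : IsOpen U)
    {σ : EuclideanSpace ℝ (Fin n) → N}
    (hσ : ContMDiffOn 𝓘(ℝ, EuclideanSpace ℝ (Fin n)) (𝓡 n) ∞ σ U)
    {x : EuclideanSpace ℝ (Fin n)} (hx : x ∈ U) (hinj : Function.Injective (differential σ x)) :
    ∃ χ ∈ IsManifold.maximalAtlas (𝓡 n) ∞ N, x ∈ χ.target ∧ χ.target ⊆ U ∧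
      Set.EqOn χ.symm σ χ.target := by
  set ψ := chartAt (EuclideanSpace ℝ (Fin n)) (σ x)
  have hψ : ψ ∈ IsManifold.maximalAtlas (𝓡 n) ∞ N := IsManifold.chart_mem_maximalAtlas _
  set V := U ∩ σ ⁻¹' ψ.source
  have hV : IsOpen V := hσ.continuousOn.isOpen_inter_preimage hU ψ.open_source
  have hxV : x ∈ V := ⟨hx, mem_chart_source _ _⟩
  set F : EuclideanSpace ℝ (Fin n) → EuclideanSpace ℝ (Fin n) := fun y => ψ (σ y)
  have hF : ContDiffOn ℝ ∞ F V := by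
    rw [← contMDiffOn_iff_contDiffOn]
    exact (contMDiffOn_of_mem_maximalAtlas hψ).comp (hσ.mono Set.inter_subset_left) fun y hy => hy.2
  have hFx : Function.Injective (fderiv ℝ F x) := by
    intro v w hvw
    have e (u : EuclideanSpace ℝ (Fin n)) := chartDifferential_differential (χ := ψ) (φ := σ)
      (mdifferentiableAt_chart hψ hxV.2)
      ((hσ.contMDiffAt (hU.mem_nhds hx)).mdifferentiableAt (by simp)) u
    have h1 : chartDifferential ψ (σ x) (differential σ x v)
        = chartDifferential ψ (σ x) (differential σ x w) := by rw [e, e]; exact hvw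
    have hl : Function.LeftInverse (differential ψ.symm (ψ (σ x)))
        (chartDifferential ψ (σ x)) := differential_symm_chartDifferential hψ hxV.2
    exact hinj (hl.injective h1)
  -- The local inverse is restricted to points where the differential is invertible, so that it is
  -- smooth on its whole domain and not only at the image of $x$.
  set D := V ∩ fderiv ℝ F ⁻¹' Set.range ((↑) : (EuclideanSpace ℝ (Fin n) ≃L[ℝ]
    EuclideanSpace ℝ (Fin n)) → EuclideanSpace ℝ (Fin n) →L[ℝ] EuclideanSpace ℝ (Fin n))
  have hD : IsOpen D := (hF.continuousOn_fderiv_of_isOpen hV (by simp)).isOpen_inter_preimage hV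
    ContinuousLinearEquiv.isOpen
  have hxD : x ∈ D := ⟨hxV, (LinearEquiv.ofInjectiveEndo (fderiv ℝ F x).toLinearMap
    hFx).toContinuousLinearEquiv, by ext1; rfl⟩
  obtain ⟨L, hL⟩ := hxD.2
  have hstrict : HasStrictFDerivAt F (L : EuclideanSpace ℝ (Fin n) →L[ℝ]
      EuclideanSpace ℝ (Fin n)) x := by
    rw [hL]
    exact (hF.contDiffAt (hV.mem_nhds hxV)).hasStrictFDerivAt (by simp)
  set R := (hstrict.toOpenPartialHomeomorph F).restrOpen D hD
  have hRF : ∀ y, R y = F y := fun y => rfl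
  have hxR : x ∈ R.source := ⟨hstrict.mem_toOpenPartialHomeomorph_source, hxD⟩
  have hRD : R.source ⊆ D := fun y hy => hy.2
  have hRsymm : ContDiffOn ℝ ∞ R.symm R.target := by
    intro z hz
    have hz' := R.map_target hz
    obtain ⟨hyV, L', hL'⟩ := hRD hz'
    have hc := hF.contDiffAt (hV.mem_nhds hyV)
    refine (R.contDiffAt_symm (f₀' := L') hz ?_ hc).contDiffWithinAt
    rw [hL']
    exact (hc.differentiableAt (by simp)).hasFDerivAt
  refine ⟨ψ.trans R.symm, ?_, ?_, ?_, ?_⟩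
  · refine OpenPartialHomeomorph.mem_maximalAtlas_of_contMDiffOn _ ?_ ?_
    · exact hRsymm.contMDiffOn.comp
        ((contMDiffOn_of_mem_maximalAtlas hψ).mono fun y hy => hy.1) fun y hy => hy.2
    · exact (contMDiffOn_symm_of_mem_maximalAtlas hψ).comp
        ((hF.mono fun y hy => (hRD hy.1).1).contMDiffOn) fun y hy => hy.2
  · exact ⟨hxR, ψ.map_source hxV.2⟩
  · exact fun y hy => (hRD hy.1).1.1
  · intro y hy
    exact ψ.left_inv (hRD hy.1).1.2

end Charts

end GeodesicCoords

end

noncomputable section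

namespace GeodesicCoords

/-! ### Parallel transport is isometric -/

section ParallelTransport

lemma fderiv_apply_eq_sum_pd {n : ℕ} (f : EuclideanSpace ℝ (Fin n) → ℝ)
    (x v : EuclideanSpace ℝ (Fin n)) : fderiv ℝ f x v = ∑ c, v c * pd c f x := by
  have e : v = ∑ a, v a • EuclideanSpace.single a (1 : ℝ) := by
    simpa using ((EuclideanSpace.basisFun (Fin n) ℝ).sum_repr v).symm
  conv_lhs => rw [e]
  simp [pd]

/-- Matches a term from the derivative of the metric with a term from the parallel equation, so that
the two cancel in `hasDerivAt_metric_parallel`. -/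
lemma sum_connection_comm {n : ℕ} (v g X : Fin n → ℝ) (C : Fin n → Fin n → Fin n → ℝ) :
    ∑ a, (∑ c, v c * ∑ i, g i * C i c a) * X a = ∑ i, g i * ∑ c, ∑ a, C i c a * v c * X a := by
  simp only [Finset.mul_sum, Finset.sum_mul]
  calc _ = ∑ a, ∑ i, ∑ c, v c * (g i * C i c a) * X a :=
        Finset.sum_congr rfl fun a _ => Finset.sum_comm
    _ = ∑ i, ∑ a, ∑ c, v c * (g i * C i c a) * X a := Finset.sum_comm
    _ = ∑ i, ∑ c, ∑ a, v c * (g i * C i c a) * X a :=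
        Finset.sum_congr rfl fun i _ => Finset.sum_comm
    _ = _ := Finset.sum_congr rfl fun i _ => Finset.sum_congr rfl fun c _ =>
        Finset.sum_congr rfl fun a _ => by ring

/-- The scalar product of two parallel fields is constant: the version in coordinates. -/
lemma hasDerivAt_metric_parallel {n : ℕ}
    {G : EuclideanSpace ℝ (Fin n) → Matrix (Fin n) (Fin n) ℝ}
    {c : ℝ → EuclideanSpace ℝ (Fin n)} {v : EuclideanSpace ℝ (Fin n)} {t : ℝ}
    (hs : ∀ y a b, G y a b = G y b a) (hdet : IsUnit (G (c t)).det)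
    (hG : ∀ a b, DifferentiableAt ℝ (fun y => G y a b) (c t)) (hc : HasDerivAt c v t)
    {X Y : ℝ → Fin n → ℝ}
    (hX : ∀ k, HasDerivAt (fun s => X s k)
      (-∑ i, ∑ j, christoffel G k i j (c t) * v i * X t j) t)
    (hY : ∀ k, HasDerivAt (fun s => Y s k)
      (-∑ i, ∑ j, christoffel G k i j (c t) * v i * Y t j) t) :
    HasDerivAt (fun s => ∑ a, ∑ b, G (c s) a b * X s a * Y s b) 0 t := by
  have hg (a b : Fin n) : HasDerivAt (fun s => G (c s) a b)
      (∑ d, v d * (∑ i, G (c t) a i * christoffel G i d b (c t))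
        + ∑ d, v d * (∑ i, G (c t) b i * christoffel G i d a (c t))) t := by
    have h := (hG a b).hasFDerivAt.comp_hasDerivAt t hc
    rw [fderiv_apply_eq_sum_pd] at h
    simp only [pd_metric hs hdet, mul_add, Finset.sum_add_distrib] at h
    exact h
  have h := HasDerivAt.fun_sum (u := Finset.univ) fun a _ =>
    HasDerivAt.fun_sum (u := Finset.univ) fun b _ => ((hg a b).mul (hX a)).mul (hY b)
  refine h.congr_deriv ?_
  -- By metric compatibility the derivative of $G_{ab}$ along the curve is $P_{ab}+P_{ba}$; one
  -- summand cancels against $Y'$, the other against $X'$.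
  set P : Fin n → Fin n → ℝ := fun a b => ∑ d, v d * ∑ i, G (c t) a i * christoffel G i d b (c t)
  set x : Fin n → ℝ := fun k => ∑ i, ∑ j, christoffel G k i j (c t) * v i * X t j
  set y : Fin n → ℝ := fun k => ∑ i, ∑ j, christoffel G k i j (c t) * v i * Y t j
  have h1 (a : Fin n) : ∑ b, P a b * Y t b = ∑ b, G (c t) a b * y b :=
    sum_connection_comm _ _ _ _
  have h2 (b : Fin n) : ∑ a, P b a * X t a = ∑ a, G (c t) b a * x a :=
    sum_connection_comm _ _ _ _
  have e : ∀ a b, ((P a b + P b a) * X t a + G (c t) a b * -x a) * Y t b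
        + G (c t) a b * X t a * -y b
      = X t a * (P a b * Y t b - G (c t) a b * y b)
        + Y t b * (P b a * X t a - G (c t) b a * x a) := fun a b => by
    rw [hs (c t) b a]
    ring
  have hz1 : ∑ a, ∑ b, X t a * (P a b * Y t b - G (c t) a b * y b) = 0 :=
    Finset.sum_eq_zero fun a _ => by
      rw [← Finset.mul_sum, Finset.sum_sub_distrib, h1, sub_self, mul_zero]
  have hz2 : ∑ a, ∑ b, Y t b * (P b a * X t a - G (c t) b a * x a) = 0 := by
    rw [Finset.sum_comm]
    exact Finset.sum_eq_zero fun b _ => by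
      rw [← Finset.mul_sum, Finset.sum_sub_distrib, h2, sub_self, mul_zero]
  refine (Finset.sum_congr rfl fun a _ => Finset.sum_congr rfl fun b _ => e a b).trans ?_
  simp only [Finset.sum_add_distrib]
  rw [hz1, hz2, add_zero]

variable {n : ℕ} {N : Type*} [TopologicalSpace N] [ChartedSpace (EuclideanSpace ℝ (Fin n)) N]
  [IsManifold (𝓡 n) ∞ N]

/-- Parallel transport is isometric. -/
lemma innerAt_eq_of_isParallelOn (h : Metric n N) {γ : ℝ → N}
    (hγ : ∀ t, MDifferentiableAt 𝓘(ℝ, ℝ) (𝓡 n) γ t)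
    {V W : (t : ℝ) → TangentSpace (𝓡 n) (γ t)} (hV : IsParallelOn h γ V Set.univ)
    (hW : IsParallelOn h γ W Set.univ) (t : ℝ) :
    innerAt h (γ t) (V t) (W t) = innerAt h (γ 0) (V 0) (W 0) := by
  have key : ∀ t, HasDerivAt (fun s => innerAt h (γ s) (V s) (W s)) 0 t := by
    intro t
    set χ := chartAt (EuclideanSpace ℝ (Fin n)) (γ t)
    have hχ : χ ∈ IsManifold.maximalAtlas (𝓡 n) ∞ N := IsManifold.chart_mem_maximalAtlas _
    have ht : γ t ∈ χ.source := mem_chart_source _ _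
    have hc := chartDifferential_velocityVec (mdifferentiableAt_chart hχ ht) (hγ t)
    have hd := hasDerivAt_metric_parallel (G := metricComp h χ.symm) (metricComp_symm h _)
      (isUnit_det_metricComp h (injective_differential_symm hχ (χ.map_source ht)))
      (fun a b => differentiableAt_of_smoothOn χ.open_target (contDiffOn_metricComp h
        χ.open_target (contMDiffOn_symm_of_mem_maximalAtlas hχ) a b) (χ.map_source ht)) hc
      (X := fun s => vecComp χ (γ s) (V s)) (Y := fun s => vecComp χ (γ s) (W s))
      (hV t trivial χ hχ ht) (hW t trivial χ hχ ht)
    refine hd.congr_of_eventuallyEq ?_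
    filter_upwards [(hγ t).continuousAt.preimage_mem_nhds (χ.open_source.mem_nhds ht)] with s hs
    exact innerAt_eq_sum h hχ hs _ _
  exact is_const_of_deriv_eq_zero (fun t => (key t).differentiableAt) (fun t => (key t).deriv) t 0

end ParallelTransport

/-! ### First-order flatness of geodesic normal coordinates -/

section NormalCoordinates

variable {n : ℕ} [NeZero n]

lemma scaleTransversal_eq (s : ℝ) (x : EuclideanSpace ℝ (Fin n)) :
    scaleTransversal s x = axis (x 0) + s • (x - axis (x 0)) := by
  ext i
  by_cases hi : i = 0
  · subst hi
    simp [scaleTransversal, axis]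
  · simp [scaleTransversal, axis, hi]

lemma hasDerivAt_scaleTransversal (s : ℝ) (x : EuclideanSpace ℝ (Fin n)) :
    HasDerivAt (fun r => scaleTransversal r x) (x - axis (x 0)) s := by
  simp only [scaleTransversal_eq]
  simpa using ((hasDerivAt_id s).smul_const (x - axis (x 0))).const_add (axis (x 0))

lemma scaleTransversal_zero (x : EuclideanSpace ℝ (Fin n)) :
    scaleTransversal 0 x = axis (x 0) := by
  rw [scaleTransversal_eq, zero_smul, add_zero]

lemma axis_apply_zero (t : ℝ) : (axis t : EuclideanSpace ℝ (Fin n)) 0 = t := by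
  simp [axis]

/-- A neighbourhood of the axis contains small transversal vectors. -/
lemma exists_axis_add_mem {U : Set (EuclideanSpace ℝ (Fin n))} (hU : IsOpen U) {t : ℝ}
    (ht : axis t ∈ U) (w : EuclideanSpace ℝ (Fin n)) :
    ∃ ε : ℝ, ε ≠ 0 ∧ axis t + ε • w ∈ U := by
  have hc : Continuous fun ε : ℝ => axis t + ε • w := by fun_prop
  have h0 : ∀ᶠ ε in 𝓝 (0 : ℝ), axis t + ε • w ∈ U :=
    hc.continuousAt.eventually (by simpa using hU.mem_nhds ht)
  have h1 : ∀ᶠ ε in 𝓝[≠] (0 : ℝ), axis t + ε • w ∈ U := h0.filter_mono nhdsWithin_le_nhds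
  obtain ⟨ε, h2, h3⟩ := (h1.and self_mem_nhdsWithin).exists
  exact ⟨ε, h3, h2⟩

/-- A symmetric bilinear form vanishes if its quadratic form does. -/
lemma polarize_transversal {C : Fin n → Fin n → ℝ} (hC : ∀ a b, C a b = C b a)
    (hq : ∀ w : EuclideanSpace ℝ (Fin n), w 0 = 0 → ∑ i, ∑ j, C i j * w i * w j = 0)
    {a b : Fin n} (ha : a ≠ 0) (hb : b ≠ 0) : C a b = 0 := by
  have hs (a b : Fin n) : ∑ i, ∑ j, C i j * (EuclideanSpace.single a (1 : ℝ)) i *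
      (EuclideanSpace.single b (1 : ℝ)) j = C a b := by simp
  have h1 := hq (EuclideanSpace.single a 1) (by simp [ha.symm])
  have h2 := hq (EuclideanSpace.single b 1) (by simp [hb.symm])
  have h3 := hq (EuclideanSpace.single a 1 + EuclideanSpace.single b 1)
    (by simp [ha.symm, hb.symm])
  simp only [PiLp.add_apply, mul_add, add_mul, Finset.sum_add_distrib, hs] at h1 h2 h3
  linarith [hC a b]

variable {N : Type*} [TopologicalSpace N] [ChartedSpace (EuclideanSpace ℝ (Fin n)) N]
  [IsManifold (𝓡 n) ∞ N] {h : Metric n N} {γ : ℝ → N}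
  {e : Fin n → (t : ℝ) → TangentSpace (𝓡 n) (γ t)}
  {U : Set (EuclideanSpace ℝ (Fin n))} {σ : EuclideanSpace ℝ (Fin n) → N}

namespace IsGeodesicNormalCoordinates

lemma axis_eq (hσ : IsGeodesicNormalCoordinates h γ e U σ) (t : ℝ) : σ (axis t) = γ t := by
  have h1 := congrArg Bundle.TotalSpace.proj (hσ.initial _ (hσ.axis_mem t))
  simpa [scaleTransversal_zero, axis_apply_zero] using h1

lemma mdifferentiableAt (hσ : IsGeodesicNormalCoordinates h γ e U σ)
    {x : EuclideanSpace ℝ (Fin n)} (hx : x ∈ U) :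
    MDifferentiableAt 𝓘(ℝ, EuclideanSpace ℝ (Fin n)) (𝓡 n) σ x :=
  (hσ.smooth.contMDiffAt (hσ.isOpen.mem_nhds hx)).mdifferentiableAt (by simp)

lemma velocityVec_transversal (hσ : IsGeodesicNormalCoordinates h γ e U σ)
    {x : EuclideanSpace ℝ (Fin n)} {s : ℝ} (hx : scaleTransversal s x ∈ U) :
    velocityVec (fun r => σ (scaleTransversal r x)) s
      = differential σ (scaleTransversal s x) (x - axis (x 0)) :=
  velocityVec_comp (hasDerivAt_scaleTransversal s x) (hσ.mdifferentiableAt hx)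

/-- For $j=0$ this is the velocity of the axis curve $\gamma$; for $j\ne0$ it is the prescribed
initial velocity of a transversal geodesic. -/
lemma differential_axis (hσ : IsGeodesicNormalCoordinates h γ e U σ)
    (he : IsParallelFrame h γ e) (t : ℝ) (j : Fin n) :
    differential σ (axis t) (EuclideanSpace.single j 1) = e j t := by
  by_cases hj : j = 0
  · subst hj
    rw [← velocityVec_comp (hasDerivAt_axis t) (hσ.mdifferentiableAt (hσ.axis_mem t)), he.first]
    have hc : (fun r => σ (axis r)) = γ := funext hσ.axis_eq
    rw [hc]
    rfl
  -- The unit vector itself may lead out of $U$; a small multiple does not, and $\varepsilon$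
  -- cancels at the end by linearity.
  · obtain ⟨ε, hε, hx⟩ := exists_axis_add_mem hσ.isOpen (hσ.axis_mem t)
      (EuclideanSpace.single j (1 : ℝ))
    set x := axis t + ε • EuclideanSpace.single j (1 : ℝ) with hxdef
    have hx0 : x 0 = t := by simp [hxdef, axis, Ne.symm hj]
    have h1 : velocityVec (fun s => σ (scaleTransversal s x)) 0
        = ∑ k ∈ Finset.univ.filter (· ≠ (0 : Fin n)),
          x k • (show EuclideanSpace ℝ (Fin n) from e k (x 0)) :=
      -- The two vectors sit over base points that agree only propositionally, but all tangent
      -- spaces are the same model space by definition.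
      eq_of_heq (Bundle.TotalSpace.mk.inj (hσ.initial x hx)).2
    have hU : scaleTransversal 0 x ∈ U := by
      rw [scaleTransversal_zero]
      exact hσ.axis_mem _
    rw [hσ.velocityVec_transversal hU, scaleTransversal_zero, hx0, Finset.sum_eq_single j] at h1
    · have h2 : x - axis t = ε • EuclideanSpace.single j (1 : ℝ) := by simp [hxdef]
      have h3 : x j = ε := by simp [hxdef, axis, hj]
      rw [h2, map_smul, h3] at h1
      exact smul_right_injective _ hε h1
    · intro k hk hkj
      have hk0 : k ≠ 0 := by simpa using hk
      have h3 : x k = 0 := by simp [hxdef, axis, hk0, hkj]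
      rw [h3, zero_smul]
    · intro hj'
      simp [hj] at hj'

lemma metricComp_axis (hσ : IsGeodesicNormalCoordinates h γ e U σ)
    (he : IsParallelFrame h γ e) (hγ : ∀ t, MDifferentiableAt 𝓘(ℝ, ℝ) (𝓡 n) γ t) (t : ℝ) :
    metricComp h σ (axis t) = 1 := by
  ext i j
  rw [metricComp_apply, hσ.differential_axis he, hσ.differential_axis he, hσ.axis_eq,
    innerAt_eq_of_isParallelOn h hγ (he.parallel i) (he.parallel j), Matrix.one_apply]
  exact he.orthonormal i j

lemma injective_differential_axis (hσ : IsGeodesicNormalCoordinates h γ e U σ)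
    (he : IsParallelFrame h γ e) (hγ : ∀ t, MDifferentiableAt 𝓘(ℝ, ℝ) (𝓡 n) γ t) (t : ℝ) :
    Function.Injective (differential σ (axis t)) := by
  rw [injective_iff_map_eq_zero]
  intro v hv
  ext k
  have h1 := sum_metricComp h σ (axis t) v (EuclideanSpace.single k 1)
  rw [hv, hσ.metricComp_axis he hγ] at h1
  -- Since the Gram matrix is the identity, pairing with the image of the $k$-th basis vector
  -- returns the coordinate $v_k$.
  simpa [Matrix.one_apply] using h1.symm

/-- The chart `χ` is a local inverse of the parametrization `σ` around the axis point at `t`. -/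
structure IsInverseChart (χ : OpenPartialHomeomorph N (EuclideanSpace ℝ (Fin n)))
    (σ : EuclideanSpace ℝ (Fin n) → N) (t : ℝ) : Prop where
  mem_maximalAtlas : χ ∈ IsManifold.maximalAtlas (𝓡 n) ∞ N
  axis_mem : axis t ∈ χ.target
  eqOn : Set.EqOn χ.symm σ χ.target

namespace IsInverseChart

variable {χ : OpenPartialHomeomorph N (EuclideanSpace ℝ (Fin n))} {t : ℝ}

omit [IsManifold (𝓡 n) ∞ N] in
lemma mem_source (hχ : IsInverseChart χ σ t) {x : EuclideanSpace ℝ (Fin n)}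
    (hx : x ∈ χ.target) : σ x ∈ χ.source :=
  hχ.eqOn hx ▸ χ.map_target hx

omit [IsManifold (𝓡 n) ∞ N] in
lemma apply (hχ : IsInverseChart χ σ t) {x : EuclideanSpace ℝ (Fin n)}
    (hx : x ∈ χ.target) : χ (σ x) = x :=
  hχ.eqOn hx ▸ χ.right_inv hx

lemma metricComp_eventuallyEq (hχ : IsInverseChart χ σ t) (h : Metric n N) :
    metricComp h χ.symm =ᶠ[𝓝 (axis t)] metricComp h σ :=
  GeodesicCoords.metricComp_eventuallyEq h
    (hχ.eqOn.eventuallyEq_of_mem (χ.open_target.mem_nhds hχ.axis_mem))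

omit [IsManifold (𝓡 n) ∞ N] in
lemma eventually_axis_mem (hχ : IsInverseChart χ σ t) : ∀ᶠ s in 𝓝 t, axis s ∈ χ.target :=
  (hasDerivAt_axis t).continuousAt.eventually (χ.open_target.mem_nhds hχ.axis_mem)

end IsInverseChart

lemma exists_isInverseChart (hσ : IsGeodesicNormalCoordinates h γ e U σ)
    (he : IsParallelFrame h γ e) (hγ : ∀ t, MDifferentiableAt 𝓘(ℝ, ℝ) (𝓡 n) γ t) (t : ℝ) :
    ∃ χ : OpenPartialHomeomorph N (EuclideanSpace ℝ (Fin n)), IsInverseChart χ σ t ∧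
      χ.target ⊆ U := by
  obtain ⟨χ, h1, h2, h3, h4⟩ := exists_chart_symm_eqOn hσ.isOpen hσ.smooth (hσ.axis_mem t)
    (hσ.injective_differential_axis he hγ t)
  exact ⟨χ, ⟨h1, h2, h4⟩, h3⟩

lemma vecComp_frame (hσ : IsGeodesicNormalCoordinates h γ e U σ) (he : IsParallelFrame h γ e)
    {χ : OpenPartialHomeomorph N (EuclideanSpace ℝ (Fin n))} {t s : ℝ}
    (hχ : IsInverseChart χ σ t) (hs : axis s ∈ χ.target) (i k : Fin n) :
    vecComp χ (γ s) (e k s) i = if i = k then 1 else 0 := by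
  have h1 := chartDifferential_differential_of_eqOn hχ.mem_maximalAtlas hχ.eqOn hs
    (EuclideanSpace.single k 1)
  rw [hσ.differential_axis he, hσ.axis_eq] at h1
  rw [vecComp_eq, h1]
  simp

/-- In the inverse chart $e_k$ has constant components $\delta^i_k$ and $\dot\gamma=e_0$, so the
parallel equation collapses to $0=-\Gamma^i_{0k}$. -/
lemma christoffel_zero_axis (hσ : IsGeodesicNormalCoordinates h γ e U σ)
    (he : IsParallelFrame h γ e) (hγ : ∀ t, MDifferentiableAt 𝓘(ℝ, ℝ) (𝓡 n) γ t) (t : ℝ)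
    (i k : Fin n) : christoffel (metricComp h σ) i 0 k (axis t) = 0 := by
  obtain ⟨χ, hχ, -⟩ := hσ.exists_isInverseChart he hγ t
  have hsrc : γ t ∈ χ.source := hσ.axis_eq t ▸ hχ.mem_source hχ.axis_mem
  have hχγ : χ (γ t) = axis t := by rw [← hσ.axis_eq, hχ.apply hχ.axis_mem]
  have h1 := he.parallel k t trivial χ hχ.mem_maximalAtlas hsrc i
  have h2 : (fun s => vecComp χ (γ s) (e k s) i) =ᶠ[𝓝 t] fun _ => if i = k then (1 : ℝ) else 0 :=
    hχ.eventually_axis_mem.mono fun s hs => hσ.vecComp_frame he hχ hs i k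
  have h3 := h1.unique ((hasDerivAt_const t _).congr_of_eventuallyEq h2)
  simp only [← he.first, hσ.vecComp_frame he hχ hχ.axis_mem, hχγ,
    (christoffel_eventuallyEq (hχ.metricComp_eventuallyEq h) _ _ _).self_of_nhds] at h3
  simpa using h3

/-- In the inverse chart the geodesic $s\mapsto\sigma(x^1,s\hat x)$ has constant velocity
$\varepsilon w$. The geodesic equation at $s=0$ leaves $\varepsilon^2\,\Gamma^i_{ab}w^aw^b=0$. -/
lemma christoffel_transversal_axis (hσ : IsGeodesicNormalCoordinates h γ e U σ)
    (he : IsParallelFrame h γ e) (hγ : ∀ t, MDifferentiableAt 𝓘(ℝ, ℝ) (𝓡 n) γ t) (t : ℝ)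
    (i : Fin n) {j k : Fin n} (hj : j ≠ 0) (hk : k ≠ 0) :
    christoffel (metricComp h σ) i j k (axis t) = 0 := by
  refine polarize_transversal (C := fun j k => christoffel (metricComp h σ) i j k (axis t))
    (fun a b => christoffel_symm (metricComp_symm h σ) i a b) (fun w hw => ?_) hj hk
  obtain ⟨χ, hχ, hχU⟩ := hσ.exists_isInverseChart he hγ t
  obtain ⟨ε, hε, hx⟩ := exists_axis_add_mem hσ.isOpen (hσ.axis_mem t) w
  set x := axis t + ε • w with hxdef
  have hx0 : x 0 = t := by simp [hxdef, axis, hw]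
  have hxw : x - axis (x 0) = ε • w := by rw [hx0, hxdef, add_sub_cancel_left]
  have hs0 : scaleTransversal 0 x = axis t := by rw [scaleTransversal_zero, hx0]
  have hvel {s : ℝ} (hs : scaleTransversal s x ∈ χ.target) (l : Fin n) :
      vecComp χ (σ (scaleTransversal s x))
        (velocity (fun r => σ (scaleTransversal r x)) s) l = ε * w l := by
    have h1 : velocity (fun r => σ (scaleTransversal r x)) s
        = differential σ (scaleTransversal s x) (x - axis (x 0)) :=
      hσ.velocityVec_transversal (hχU hs)
    rw [vecComp_eq, h1, chartDifferential_differential_of_eqOn hχ.mem_maximalAtlas hχ.eqOn hs,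
      hxw]
    rfl
  have h0 : scaleTransversal 0 x ∈ χ.target := hs0 ▸ hχ.axis_mem
  have h1 := (hσ.geodesic x hx).2 0 (hχU h0) χ hχ.mem_maximalAtlas (hχ.mem_source h0) i
  have h2 : (fun s => vecComp χ (σ (scaleTransversal s x))
      (velocity (fun r => σ (scaleTransversal r x)) s) i) =ᶠ[𝓝 0] fun _ => ε * w i :=
    ((hasDerivAt_scaleTransversal 0 x).continuousAt.eventually
      (χ.open_target.mem_nhds h0)).mono fun s hs => hvel hs i
  have h3 := h1.unique ((hasDerivAt_const 0 _).congr_of_eventuallyEq h2)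
  simp only [hvel h0, hs0, hχ.apply hχ.axis_mem,
    (christoffel_eventuallyEq (hχ.metricComp_eventuallyEq h) _ _ _).self_of_nhds] at h3
  have h4 : ∑ a, ∑ b, christoffel (metricComp h σ) i a b (axis t) * (ε * w a) * (ε * w b)
      = ε ^ 2 * ∑ a, ∑ b, christoffel (metricComp h σ) i a b (axis t) * w a * w b := by
    simp only [Finset.mul_sum]
    exact Finset.sum_congr rfl fun a _ => Finset.sum_congr rfl fun b _ => by ring
  rw [neg_eq_zero, h4] at h3
  exact (mul_eq_zero.1 h3).resolve_left (pow_ne_zero 2 hε)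

lemma covDeriv_riemann_axis (hσ : IsGeodesicNormalCoordinates h γ e U σ)
    (he : IsParallelFrame h γ e) (hγ : ∀ t, MDifferentiableAt 𝓘(ℝ, ℝ) (𝓡 n) γ t)
    (hsymm : IsLocallySymmetricAlong h γ) (t : ℝ) (a : Fin 3 → Fin n) (i : Fin n) :
    covDeriv (metricComp h σ) (riemann (metricComp h σ)) (axis t)
      (Fin.cons (α := fun _ : Fin 4 => Fin n) 0 a) i = 0 := by
  obtain ⟨χ, hχ, -⟩ := hσ.exists_isInverseChart he hγ t
  have hsrc : γ t ∈ χ.source := hσ.axis_eq t ▸ hχ.mem_source hχ.axis_mem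
  have hχγ : χ (γ t) = axis t := by rw [← hσ.axis_eq, hχ.apply hχ.axis_mem]
  -- Only order zero of local symmetry enters; the sum over $b$ reduces to $b=0$ because
  -- $\dot\gamma$ has components $\delta^b_0$.
  have h1 := hsymm 0 t χ hχ.mem_maximalAtlas hsrc a i
  simp only [← he.first, hσ.vecComp_frame he hχ hχ.axis_mem, hχγ, ite_mul, one_mul, zero_mul,
    Finset.sum_ite_eq', Finset.mem_univ, if_true] at h1
  rw [← covDeriv_riemann_congr (hχ.metricComp_eventuallyEq h)]
  exact h1

/-- Away from the axis $\sigma$ may degenerate, so $U$ is cut down to the open set where the Gram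
determinant is nonzero; the axis stays inside, the determinant there being $1$. -/
lemma isFlatToFirstOrder (hσ : IsGeodesicNormalCoordinates h γ e U σ)
    (he : IsParallelFrame h γ e) (hγ : ∀ t, MDifferentiableAt 𝓘(ℝ, ℝ) (𝓡 n) γ t)
    (hsymm : IsLocallySymmetricAlong h γ) :
    IsFlatToFirstOrder (metricComp h σ) (U ∩ (fun x => (metricComp h σ x).det) ⁻¹' {0}ᶜ) := by
  have hG (a b : Fin n) := contDiffOn_metricComp h hσ.isOpen hσ.smooth a b
  refine ⟨(contDiffOn_det hG).continuousOn.isOpen_inter_preimage hσ.isOpen isOpen_compl_singleton,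
    fun t => ⟨hσ.axis_mem t, ?_⟩, fun a b => (hG a b).mono Set.inter_subset_left,
    metricComp_symm h σ, fun y hy => isUnit_iff_ne_zero.2 hy.2, hσ.metricComp_axis he hγ, ?_,
    hσ.covDeriv_riemann_axis he hγ hsymm⟩
  · simp [hσ.metricComp_axis he hγ]
  · intro i j k t
    by_cases hj : j = 0
    · rw [hj]
      exact hσ.christoffel_zero_axis he hγ t i k
    · by_cases hk : k = 0
      · rw [christoffel_symm (metricComp_symm h σ), hk]
        exact hσ.christoffel_zero_axis he hγ t i j
      · exact hσ.christoffel_transversal_axis he hγ t i hj hk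

end IsGeodesicNormalCoordinates

end NormalCoordinates

end GeodesicCoords

end

theorem mainTheorem5 {n : ℕ} [NeZero n] {N : Type*} [TopologicalSpace N]
    [ChartedSpace (EuclideanSpace ℝ (Fin n)) N] [IsManifold (𝓡 n) ∞ N]
    (h : GeodesicCoords.Metric n N) (γ : ℝ → N)
    (hγ : GeodesicCoords.IsGeodesicOn h γ Set.univ)
    (hsymm : GeodesicCoords.IsLocallySymmetricAlong h γ)
    (e : Fin n → (t : ℝ) → TangentSpace (𝓡 n) (γ t))
    (he : GeodesicCoords.IsParallelFrame h γ e)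
    (U : Set (EuclideanSpace ℝ (Fin n))) (σ : EuclideanSpace ℝ (Fin n) → N)
    (hσ : GeodesicCoords.IsGeodesicNormalCoordinates h γ e U σ)
    (Γ : Fin n → Fin n → Fin n → EuclideanSpace ℝ (Fin n) → ℝ)
    (hΓ : Γ = GeodesicCoords.christoffel (GeodesicCoords.metricComp h σ)) :
    (∀ (t : ℝ) (i j k : Fin n), ContDiffAt ℝ ∞ (Γ i j k) (GeodesicCoords.axis t)) ∧
    ∀ (q : ℕ) (t : ℝ),
      (∀ i j k : Fin n, (GeodesicCoords.pd 0)^[q]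
        (GeodesicCoords.pd 0 (GeodesicCoords.pd j (Γ i 0 k))) (GeodesicCoords.axis t) = 0) ∧
      (∀ i k : Fin n, (GeodesicCoords.pd 0)^[q]
        (GeodesicCoords.pd 0 (Γ i 0 k)) (GeodesicCoords.axis t) = 0) ∧
      (GeodesicCoords.pd 0)^[q] (Γ 0 0 0) (GeodesicCoords.axis t) = 0 ∧
      (∀ k : Fin n, (GeodesicCoords.pd 0)^[q]
        (GeodesicCoords.pd k (Γ 0 0 0)) (GeodesicCoords.axis t) = 0) ∧
      (∀ j k : Fin n, (GeodesicCoords.pd 0)^[q]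
        (GeodesicCoords.pd j (GeodesicCoords.pd k (Γ 0 0 0))) (GeodesicCoords.axis t) = 0) := by
  have hflat := hσ.isFlatToFirstOrder he
    (fun s => (hγ.1.contMDiffAt Filter.univ_mem).mdifferentiableAt (by simp)) hsymm
  have hO := hflat.isOpen
  have hax := hflat.axis_mem
  have hC := hflat.smooth_christoffel
  subst hΓ
  open GeodesicCoords in
  exact ⟨fun t i j k => (hC i j k).contDiffAt (hO.mem_nhds (hax t)), fun q t =>
    ⟨fun i j k => iterate_pd_zero_axis hO hax
        (contDiffOn_pd hO (contDiffOn_pd hO (hC i 0 k) j) 0) (hflat.pd_zero_pd_christoffel i j k) q t,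
      fun i k => iterate_pd_zero_axis hO hax (contDiffOn_pd hO (hC i 0 k) 0)
        -- The case $q=1$ says that $\partial_0\Gamma^i_{0k}$ itself vanishes on the axis.
        (iterate_pd_zero_axis hO hax (hC i 0 k) (hflat.christoffel_axis i 0 k) 1) q t,
      iterate_pd_zero_axis hO hax (hC 0 0 0) (hflat.christoffel_axis 0 0 0) q t,
      fun k => iterate_pd_zero_axis hO hax (contDiffOn_pd hO (hC 0 0 0) k)
        (hflat.pd_christoffel_axis k) q t,
      fun j k => iterate_pd_zero_axis hO hax (contDiffOn_pd hO (contDiffOn_pd hO (hC 0 0 0) k) j)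
        (hflat.pd_pd_christoffel_axis j k) q t⟩⟩
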